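/- Let $G$ be a finite simple undirected graph. A configuration assigns to each vertex $v$ a number $c(v)\ge 0$ of chips. In ordinary chip-firing (integer configurations) a vertex $v$ may be fired when $c(v)\ge\deg(v)$; it then loses $\deg(v)$ chips and each neighbour of $v$ gains one chip. For a real number $p\in(0,1)$, in fractional chip-firing (real configurations) a vertex $v$ may be fired when $c(v)\ge p\deg(v)$; it then loses $p\deg(v)$ chips and each neighbour of $v$ gains $p$ chips. A configuration is volatile if there is an infinite sequence of vertices that may be fired in order, and stable if no vertex may be fired. In the (ordinary or fractional) toppling game on $G$ there are initially no chips; the players Max and Min, with Max moving first, alternately add one whole chip to a vertex of their choice, and after each turn vertices are fired until a stable configuration arises, unless the configuration is volatile, in which case the game ends. Max wants to maximize, and Min to minimize, the total number of turns (chips placed). Let $t(G)$ and $t_p(G)$ denote the numbers of turns under optimal play in the ordinary and the fractional toppling game on $G$, respectively. Let $p=p(n)\in(0,1)$ satisfy $p\gg 1/n$, that is, $pn\to\infty$ as $n\to\infty$. Then, as $n\to\infty$, $$t_p(K_n) = (1+o(1))\,p\,t(K_n) = \Theta(pn^2),$$ where $K_n$ is the complete graph on $n$ vertices. -/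

import Mathlib

open Filter Asymptotics

/-- The two players of the toppling game. -/
inductive ToppPlayer where
  | maxPlayer : ToppPlayer
  | minPlayer : ToppPlayer

section Game

variable {V R : Type*}

/-- `IsVolatileFor fires c`: there is an infinite sequence of legal firings starting at the
configuration `c`. Here `fires c c'` means that `c'` arises from `c` by legally firing one vertex. -/
def IsVolatileFor (fires : (V → R) → (V → R) → Prop) (c : V → R) : Prop :=
  ∃ s : ℕ → V → R, s 0 = c ∧ ∀ i, fires (s i) (s (i + 1))

/-- A configuration is stable if no vertex may be fired. -/
def IsStableFor (fires : (V → R) → (V → R) → Prop) (c : V → R) : Prop :=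
  ∀ c', ¬ fires c c'

/-- `s` is a stable configuration reached from `c` by finitely many (possibly zero) firings. -/
def StabilizesTo (fires : (V → R) → (V → R) → Prop) (c s : V → R) : Prop :=
  Relation.ReflTransGen fires c s ∧ IsStableFor fires s

/-- Add one chip to the vertex `v`. -/
def addChip [DecidableEq V] [Add R] [One R] (c : V → R) (v : V) : V → R :=
  fun u => if u = v then c u + 1 else c u

/-- `MinForcesWithin fires k P c`: if the current configuration is `c` (after the last chip was
placed, before any firing), and `P` is to move, then Min can guarantee that the game ends after at
most `k` further turns, whatever Max does. If `c` is volatile, the game is over. Otherwise vertices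
are fired until a stable configuration `s` arises (for the chip-firing rules below, `s` is
determined by `c`), and then the player whose turn it is adds one chip to a vertex of
`s`. -/
def MinForcesWithin [DecidableEq V] [Add R] [One R] (fires : (V → R) → (V → R) → Prop) :
    ℕ → ToppPlayer → (V → R) → Prop
  | 0, _, c => IsVolatileFor fires c
  | k + 1, .maxPlayer, c => IsVolatileFor fires c ∨
      ∃ s, StabilizesTo fires c s ∧ ∀ v, MinForcesWithin fires k .minPlayer (addChip s v)
  | k + 1, .minPlayer, c => IsVolatileFor fires c ∨
      ∃ s, StabilizesTo fires c s ∧ ∃ v, MinForcesWithin fires k .maxPlayer (addChip s v)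

/-- The number of turns of the game under optimal play, when there are no chips at the beginning
and Max moves first: the least `k` such that Min can force the game to end within `k` turns. -/
noncomputable def gameLength [DecidableEq V] [Add R] [One R] [Zero R]
    (fires : (V → R) → (V → R) → Prop) : ℕ :=
  sInf {k | MinForcesWithin fires k .maxPlayer (fun _ => 0)}

end Game

section Toppling

variable {V : Type*} [Fintype V] [DecidableEq V] (G : SimpleGraph V) [DecidableRel G.Adj]

/-- Ordinary chip-firing: a vertex `v` with at least `deg v` chips may be fired; it then loses
`deg v` chips and each neighbour gains one chip. -/
def OrdinaryFires (c c' : V → ℕ) : Prop :=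
  ∃ v, G.degree v ≤ c v ∧
    ∀ u, c' u = if u = v then c u - G.degree v else if G.Adj v u then c u + 1 else c u

/-- Fractional chip-firing: a vertex `v` with at least `p * deg v` chips may be fired; it then
loses `p * deg v` chips and each neighbour gains `p` chips. -/
def FractionalFires (p : ℝ) (c c' : V → ℝ) : Prop :=
  ∃ v, p * G.degree v ≤ c v ∧
    ∀ u, c' u = if u = v then c u - p * G.degree v else if G.Adj v u then c u + p else c u

/-- The toppling number `t(G)`. -/
noncomputable def topplingNumber : ℕ :=
  gameLength (OrdinaryFires G)

/-- The length `t_p(G)` of the fractional toppling game. -/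
noncomputable def fractionalTopplingNumber (p : ℝ) : ℕ :=
  gameLength (FractionalFires G p)

end Toppling

/-! Let n be the number of vertices. Measured in units of p, a fractional firing on a complete graph
is an ordinary one, and only the weight of a placed chip changes, from 1 to q = 1/p. Volatility
becomes a family of inequalities between sums of floors that is invariant under firing and monotone
(`isVolatileFor_iff`), so firings can be ignored: both games are pure placement games with chips of
weight q.

Two such games with weights at most Q are compared by simulation (`RoundsInto.simulate_aux`): Min
follows a strategy for one weight while playing with the other, ending within ℓ¹ distance O(nQ) of
an overflowing assignment. By `Overflowing.of_dist_le` the deficit in every inequality is then at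
most about εn + O(Q/ε), and placing n times the deficit on one vertex repairs it. So total weights
differ by O(εn² + nQ/ε). As Q = 1/p = o(n) and t(K_n) = Θ(n²), this error is negligible. -/

set_option linter.unusedSectionVars false

/-! ### Volatility on complete graphs and the placement game -/

section Abstract

variable {V : Type*} [Fintype V] [DecidableEq V]

/-- For `m = 0` this characterises the volatile chip assignments on the complete graph with vertex
set `V`; for `m > 0` it describes the assignments that are almost volatile. -/
def Overflowing (m : ℝ) (x : V → ℝ) : Prop :=
  ∀ j : ℤ, (j : ℝ) - m ≤ ((∑ v, ⌊(x v + j) / (Fintype.card V : ℝ)⌋ : ℤ) : ℝ)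

/-- `ForcedWithin q k P x`: with `P` to move at `x`, Min can force an overflowing assignment after
`k` placements of chips of weight `q`. -/
def ForcedWithin (q : ℝ) : ℕ → ToppPlayer → (V → ℝ) → Prop
  | 0, _, x => Overflowing 0 x
  | k + 1, .maxPlayer, x => ∀ v, ForcedWithin q k .minPlayer (x + Pi.single v q)
  | k + 1, .minPlayer, x => ∃ v, ForcedWithin q k .maxPlayer (x + Pi.single v q)

/-- `RoundsInto q U k x`: from `x`, the second of two players can force the assignment to lie in
`U` after `k` rounds in each of which both players place one chip of weight `q`. -/
def RoundsInto (q : ℝ) (U : (V → ℝ) → Prop) : ℕ → (V → ℝ) → Prop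
  | 0, x => U x
  | k + 1, x => ∀ u, ∃ v, RoundsInto q U k (x + Pi.single u q + Pi.single v q)

theorem Overflowing.mono {m : ℝ} {x y : V → ℝ} (hx : Overflowing m x) (h : x ≤ y) :
    Overflowing m y := by
  intro j
  refine (hx j).trans ?_
  exact_mod_cast Finset.sum_le_sum fun v _ => Int.floor_le_floor
    (div_le_div_of_nonneg_right (by linarith [h v]) (Nat.cast_nonneg _))

theorem le_add_single {q : ℝ} (hq : 0 ≤ q) (x : V → ℝ) (v : V) : x ≤ x + Pi.single v q :=
  le_add_of_nonneg_right (Pi.single_nonneg.2 hq)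

/-- Overflow survives further chips, so a decided game may be played on; hence `ForcedWithin` needs
no clause for early termination. -/
theorem ForcedWithin.of_overflowing [Nonempty V] {q : ℝ} (hq : 0 ≤ q) (k : ℕ) (P : ToppPlayer)
    {x : V → ℝ} (hx : Overflowing 0 x) : ForcedWithin q k P x := by
  induction k generalizing P x with
  | zero => exact hx
  | succ k ih =>
    cases P with
    | maxPlayer => exact fun v => ih _ (hx.mono (le_add_single hq x v))
    | minPlayer => exact ⟨Classical.arbitrary V, ih _ (hx.mono (le_add_single hq x _))⟩

theorem ForcedWithin.mono [Nonempty V] {q : ℝ} (hq : 0 ≤ q) {k l : ℕ} (hkl : k ≤ l)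
    {P : ToppPlayer} {x : V → ℝ} (hx : ForcedWithin q k P x) : ForcedWithin q l P x := by
  induction l generalizing k P x with
  | zero =>
    obtain rfl : k = 0 := by omega
    exact hx
  | succ l ih =>
    cases k with
    | zero => exact of_overflowing hq _ P hx
    | succ k =>
      cases P with
      | maxPlayer => exact fun v => ih (by omega) (hx v)
      | minPlayer => exact hx.imp fun v hv => ih (by omega) hv

theorem forcedWithin_iff_roundsInto (q : ℝ) (k : ℕ) (x : V → ℝ) :
    ForcedWithin q (2 * k) .maxPlayer x ↔ RoundsInto q (Overflowing 0) k x := by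
  induction k generalizing x with
  | zero => exact Iff.rfl
  | succ k ih => exact forall_congr' fun u => exists_congr fun v => ih _

/-- The chip gained everywhere shifts j by one; the n chips taken from u lower exactly one floor by
one. -/
theorem sum_floor_fire [Nonempty V] (x : V → ℝ) (u : V) (j : ℤ) :
    (∑ v, ⌊((x + 1 - Pi.single u (Fintype.card V : ℝ) : V → ℝ) v + (j : ℝ)) / (Fintype.card V : ℝ)⌋) =
      (∑ v, ⌊(x v + ((j + 1 : ℤ) : ℝ)) / (Fintype.card V : ℝ)⌋) - 1 := by
  have hn : (Fintype.card V : ℝ) ≠ 0 := by simp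
  have h1 : ∑ v, (Pi.single u 1 : V → ℤ) v = 1 := by simp
  refine Eq.trans ?_ (congrArg (_ - ·) h1)
  rw [← Finset.sum_sub_distrib]
  refine Finset.sum_congr rfl fun v _ => ?_
  rcases eq_or_ne v u with rfl | hv
  · simp only [Pi.sub_apply, Pi.add_apply, Pi.one_apply, Pi.single_eq_same]
    rw [← Int.floor_sub_one]
    congr 1
    field_simp
    simp
    ring
  · simp only [Pi.sub_apply, Pi.add_apply, Pi.one_apply, Pi.single_eq_of_ne hv, sub_zero]
    congr 2
    push_cast
    ring

theorem overflowing_fire_iff [Nonempty V] (x : V → ℝ) (u : V) :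
    Overflowing 0 (x + 1 - Pi.single u (Fintype.card V : ℝ)) ↔ Overflowing 0 x := by
  constructor
  · intro h j
    have := h (j - 1)
    rw [sum_floor_fire, sub_add_cancel] at this
    push_cast at this ⊢
    linarith
  · intro h j
    have := h (j + 1)
    rw [sum_floor_fire]
    push_cast at this ⊢
    linarith

/-- Raising j by a multiple of n raises both sides of the inequality equally, so negative j reduce
to natural ones. -/
theorem overflowing_of_forall_nat [Nonempty V] {x : V → ℝ}
    (h : ∀ i : ℕ, (i : ℤ) ≤ ∑ v, ⌊(x v + i) / (Fintype.card V : ℝ)⌋) : Overflowing 0 x := by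
  intro j
  have hn : (Fintype.card V : ℝ) ≠ 0 := by simp
  have hpos : (1 : ℤ) ≤ Fintype.card V := by exact_mod_cast Fintype.card_pos (α := V)
  obtain ⟨i, hi⟩ : ∃ i : ℕ, (i : ℤ) = j + Fintype.card V * |j| :=
    ⟨(j + Fintype.card V * |j|).toNat, Int.toNat_of_nonneg (by
      nlinarith [neg_abs_le j, abs_nonneg j])⟩
  have hi' : (i : ℝ) = j + Fintype.card V * ((|j| : ℤ) : ℝ) := by exact_mod_cast hi
  have h1 := h i
  have h2 (v : V) : ⌊(x v + i) / (Fintype.card V : ℝ)⌋ =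
      ⌊(x v + j) / (Fintype.card V : ℝ)⌋ + |j| := by
    rw [← Int.floor_add_intCast, hi']
    congr 1
    field_simp
    ring
  simp only [h2, Finset.sum_add_distrib, Finset.sum_const, Finset.card_univ, nsmul_eq_mul, hi] at h1
  rw [sub_zero]
  exact_mod_cast (add_le_add_iff_right _).1 h1

/-- Firing commutes with placing chips, so all firings can be postponed to the end, where they do
not affect overflow. -/
theorem forcedWithin_fire_iff [Nonempty V] (q : ℝ) (k : ℕ) (P : ToppPlayer) (x : V → ℝ) (u : V) :
    ForcedWithin q k P (x + 1 - Pi.single u (Fintype.card V : ℝ)) ↔ ForcedWithin q k P x := by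
  induction k generalizing P x with
  | zero => exact overflowing_fire_iff x u
  | succ k ih =>
    have h (v : V) : x + 1 - Pi.single u (Fintype.card V : ℝ) + Pi.single v q =
      x + Pi.single v q + 1 - Pi.single u (Fintype.card V : ℝ) := by abel
    cases P with
    | maxPlayer => exact forall_congr' fun v => by rw [h, ih]
    | minPlayer => exact exists_congr fun v => by rw [h, ih]

theorem Overflowing.exists_fireable [Nonempty V] {x : V → ℝ} (hx : Overflowing 0 x) :
    ∃ v, (Fintype.card V : ℝ) - 1 ≤ x v := by
  by_contra! h
  have hn : (0 : ℝ) < Fintype.card V := by simp [Fintype.card_pos]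
  have h1 := hx 1
  have h2 : (∑ v, ⌊(x v + (1 : ℤ)) / (Fintype.card V : ℝ)⌋) ≤ 0 :=
    Finset.sum_nonpos fun v _ => by
      rw [← Int.lt_add_one_iff, Int.floor_lt, div_lt_iff₀ hn]
      push_cast
      linarith [h v]
  have h3 : ((∑ v, ⌊(x v + (1 : ℤ)) / (Fintype.card V : ℝ)⌋ : ℤ) : ℝ) ≤ 0 := by exact_mod_cast h2
  push_cast at h1 h3
  linarith

theorem fire_nonneg {x : V → ℝ} (hx : 0 ≤ x) {u : V} (hu : (Fintype.card V : ℝ) - 1 ≤ x u) :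
    0 ≤ x + 1 - Pi.single u (Fintype.card V : ℝ) := by
  intro v
  have := hx v
  rcases eq_or_ne v u with rfl | hv
  · simp only [Pi.zero_apply, Pi.sub_apply, Pi.add_apply, Pi.one_apply, Pi.single_eq_same]
    linarith
  · simp only [Pi.zero_apply, Pi.sub_apply, Pi.add_apply, Pi.one_apply, Pi.single_eq_of_ne hv] at *
    linarith

theorem exists_stabilizesTo {R : Type*} {fires : (V → R) → (V → R) → Prop} {c : V → R}
    (hc : ¬ IsVolatileFor fires c) : ∃ s, StabilizesTo fires c s := by
  by_contra! h
  have h1 (d : {d // Relation.ReflTransGen fires c d}) : ∃ e, fires d.1 e := by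
    by_contra! hd
    exact h d.1 ⟨d.2, hd⟩
  choose f hf using h1
  let s : ℕ → {d // Relation.ReflTransGen fires c d} := fun i =>
    Nat.rec ⟨c, .refl⟩ (fun _ d => ⟨f d, d.2.tail (hf d)⟩) i
  exact hc ⟨fun i => (s i).1, rfl, fun i => hf (s i)⟩

/-! ### From chip-firing games to the placement game -/

section Transfer

variable [Nonempty V] {R : Type*} {fires : (V → R) → (V → R) → Prop} {φ : (V → R) → V → ℝ}

/-- After i firings the entries are still nonnegative, so their floor sum is nonnegative; undoing
the firings gives the i-th inequality. Conversely, overflow is preserved by firing and always leaves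
a vertex to fire. -/
theorem isVolatileFor_iff
    (hfire : ∀ c c', fires c c' → ∃ u, (Fintype.card V : ℝ) - 1 ≤ φ c u ∧
      φ c' = φ c + 1 - Pi.single u (Fintype.card V : ℝ))
    (hex : ∀ c u, (Fintype.card V : ℝ) - 1 ≤ φ c u → ∃ c', fires c c')
    {c : V → R} (hc : 0 ≤ φ c) : IsVolatileFor fires c ↔ Overflowing 0 (φ c) := by
  have hn : (0 : ℝ) < Fintype.card V := by simp [Fintype.card_pos]
  constructor
  · rintro ⟨s, rfl, hs⟩
    have h0 (i : ℕ) : 0 ≤ φ (s i) := by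
      induction i with
      | zero => exact hc
      | succ i ih =>
        obtain ⟨u, hu, h⟩ := hfire _ _ (hs i)
        rw [h]
        exact fire_nonneg ih hu
    have hsum (i : ℕ) (j : ℤ) : (∑ v, ⌊(φ (s i) v + j) / (Fintype.card V : ℝ)⌋) + i =
        ∑ v, ⌊(φ (s 0) v + ((j + i : ℤ) : ℝ)) / (Fintype.card V : ℝ)⌋ := by
      induction i generalizing j with
      | zero => simp
      | succ i ih =>
        obtain ⟨u, hu, h⟩ := hfire _ _ (hs i)
        have := ih (j + 1)
        rw [h, sum_floor_fire]
        push_cast at this ⊢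
        rw [show (j : ℝ) + (i + 1) = j + 1 + i by ring, ← this]
        ring
    refine overflowing_of_forall_nat fun i => ?_
    have h1 := hsum i 0
    have h2 : 0 ≤ ∑ v, ⌊(φ (s i) v + (0 : ℤ)) / (Fintype.card V : ℝ)⌋ :=
      Finset.sum_nonneg fun v _ => Int.floor_nonneg.2 (by
        have : 0 ≤ φ (s i) v := h0 i v
        push_cast
        positivity)
    push_cast at h1 h2
    rw [zero_add] at h1
    linarith
  · intro h
    have h1 (d : {d // 0 ≤ φ d ∧ Overflowing 0 (φ d)}) :
        ∃ e : {d // 0 ≤ φ d ∧ Overflowing 0 (φ d)}, fires d.1 e.1 := by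
      obtain ⟨v, hv⟩ := d.2.2.exists_fireable
      obtain ⟨e, he⟩ := hex _ _ hv
      obtain ⟨u, hu, h⟩ := hfire _ _ he
      exact ⟨⟨e, h ▸ fire_nonneg d.2.1 hu, h ▸ (overflowing_fire_iff _ _).2 d.2.2⟩, he⟩
    choose f hf using h1
    let s : ℕ → {d // 0 ≤ φ d ∧ Overflowing 0 (φ d)} := fun i =>
      Nat.rec ⟨c, hc, h⟩ (fun _ d => f d) i
    exact ⟨fun i => (s i).1, rfl, fun i => hf (s i)⟩

theorem minForcesWithin_iff [Add R] [One R] {q : ℝ} (hq : 0 ≤ q)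
    (hfire : ∀ c c', fires c c' → ∃ u, (Fintype.card V : ℝ) - 1 ≤ φ c u ∧
      φ c' = φ c + 1 - Pi.single u (Fintype.card V : ℝ))
    (hex : ∀ c u, (Fintype.card V : ℝ) - 1 ≤ φ c u → ∃ c', fires c c')
    (hadd : ∀ c v, φ (addChip c v) = φ c + Pi.single v q)
    (k : ℕ) (P : ToppPlayer) {c : V → R} (hc : 0 ≤ φ c) :
    MinForcesWithin fires k P c ↔ ForcedWithin q k P (φ c) := by
  have stab {c s : V → R} (hc : 0 ≤ φ c) (h : Relation.ReflTransGen fires c s) :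
      0 ≤ φ s ∧ ∀ k P, ForcedWithin q k P (φ s) ↔ ForcedWithin q k P (φ c) := by
    induction h with
    | refl => exact ⟨hc, fun _ _ => Iff.rfl⟩
    | tail _ hd ih =>
      obtain ⟨u, hu, h⟩ := hfire _ _ hd
      rw [h]
      exact ⟨fire_nonneg ih.1 hu, fun k P => (forcedWithin_fire_iff _ _ _ _ _).trans (ih.2 k P)⟩
  induction k generalizing P c with
  | zero =>
    cases P <;> exact isVolatileFor_iff hfire hex hc
  | succ k ih =>
    have hstep {s : V → R} (hs : 0 ≤ φ s) (v : V) (P : ToppPlayer) :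
        MinForcesWithin fires k P (addChip s v) ↔ ForcedWithin q k P (φ s + Pi.single v q) := by
      rw [← hadd]
      exact ih _ (by rw [hadd]; exact hs.trans (le_add_single hq _ _))
    by_cases hvol : IsVolatileFor fires c
    · have := (isVolatileFor_iff hfire hex hc).1 hvol
      refine iff_of_true ?_ (.of_overflowing hq _ _ this)
      cases P <;> exact Or.inl hvol
    · have hex : ∃ s, StabilizesTo fires c s := exists_stabilizesTo hvol
      cases P with
      | maxPlayer =>
        have key (s : V → R) (hs : StabilizesTo fires c s) :
            (∀ v, MinForcesWithin fires k .minPlayer (addChip s v)) ↔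
              ForcedWithin q (k + 1) .maxPlayer (φ c) := by
          rw [← (stab hc hs.1).2]
          exact forall_congr' fun v => hstep (stab hc hs.1).1 v _
        refine (or_iff_right hvol).trans ⟨fun ⟨s, hs, h⟩ => (key s hs).1 h, fun h => ?_⟩
        exact hex.imp fun s hs => ⟨hs, (key s hs).2 h⟩
      | minPlayer =>
        have key (s : V → R) (hs : StabilizesTo fires c s) :
            (∃ v, MinForcesWithin fires k .maxPlayer (addChip s v)) ↔
              ForcedWithin q (k + 1) .minPlayer (φ c) := by
          rw [← (stab hc hs.1).2]
          exact exists_congr fun v => hstep (stab hc hs.1).1 v _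
        refine (or_iff_right hvol).trans ⟨fun ⟨s, hs, h⟩ => (key s hs).1 h, fun h => ?_⟩
        exact hex.imp fun s hs => ⟨hs, (key s hs).2 h⟩

end Transfer

end Abstract

/-! ### Simulating one chip weight by another, and repairing the error -/

section Simulation

variable {V : Type*} [Fintype V] [DecidableEq V]

theorem RoundsInto.imp {q : ℝ} {U U' : (V → ℝ) → Prop} (h : ∀ x, U x → U' x) {k : ℕ} {x : V → ℝ}
    (hx : RoundsInto q U k x) : RoundsInto q U' k x := by
  induction k generalizing x with
  | zero => exact h x hx
  | succ k ih => exact fun u => (hx u).imp fun v hv => ih hv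

theorem RoundsInto.add {q : ℝ} {U : (V → ℝ) → Prop} {k l : ℕ} {x : V → ℝ}
    (hx : RoundsInto q (RoundsInto q U l) k x) : RoundsInto q U (l + k) x := by
  induction k generalizing x with
  | zero => exact hx
  | succ k ih => exact fun u => (hx u).imp fun v hv => ih hv

/-- The `ℓ¹` distance moves by at most the total weight of the chips placed. -/
theorem RoundsInto.of_dist_le [Nonempty V] {q C : ℝ} (hq : 0 ≤ q) {U : (V → ℝ) → Prop}
    {y : V → ℝ} (hy : U y) (k : ℕ) {x : V → ℝ} (h : ∑ v, |x v - y v| + 2 * q * k ≤ C) :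
    RoundsInto q (fun x => ∃ y, U y ∧ ∑ v, |x v - y v| ≤ C) k x := by
  induction k generalizing x with
  | zero => exact ⟨y, hy, by simpa using h⟩
  | succ k ih =>
    -- Any answer would do; only the weight placed counts.
    refine fun u => ⟨u, ih ?_⟩
    have h1 : ∑ v, |(x + Pi.single u q + Pi.single u q : V → ℝ) v - y v| ≤
        ∑ v, (|x v - y v| + 2 * (Pi.single u q : V → ℝ) v) := by
      refine Finset.sum_le_sum fun v _ => ?_
      have h0 : 0 ≤ (Pi.single u q : V → ℝ) v := (Pi.single_nonneg.2 hq : 0 ≤ (Pi.single u q : V → ℝ)) v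
      calc |(x + Pi.single u q + Pi.single u q : V → ℝ) v - y v|
          = |(x v - y v) + 2 * (Pi.single u q : V → ℝ) v| := by
            congr 1
            simp only [Pi.add_apply]
            ring
        _ ≤ _ := (abs_add_le _ _).trans_eq (by rw [abs_of_nonneg (mul_nonneg zero_le_two h0)])
    rw [Finset.sum_add_distrib, ← Finset.mul_sum] at h1
    simp only [Finset.sum_pi_single', Finset.mem_univ, if_true] at h1
    push_cast at h
    linarith

theorem sum_abs_le_of_neg_le {d : V → ℝ} {b : ℝ} (hb : 0 ≤ b) (hd : ∀ v, -b ≤ d v) :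
    ∑ v, |d v| ≤ ∑ v, d v + 2 * (Fintype.card V * b) := by
  have : ∑ v, |d v| ≤ ∑ v, (d v + 2 * b) := Finset.sum_le_sum fun v _ =>
    abs_le.2 ⟨by linarith [hd v], by linarith⟩
  rw [Finset.sum_add_distrib] at this
  simp only [Finset.sum_const, Finset.card_univ, nsmul_eq_mul] at this
  linarith

theorem sum_add_single (d : V → ℝ) (u : V) (q : ℝ) :
    ∑ v, (d + Pi.single u q : V → ℝ) v = ∑ v, d v + q := by
  simp [Finset.sum_add_distrib]

theorem sum_sub_single (d : V → ℝ) (u : V) (q : ℝ) :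
    ∑ v, (d - Pi.single u q : V → ℝ) v = ∑ v, d v - q := by
  simp [Finset.sum_sub_distrib]

theorem exists_nonneg_of_sum_nonneg [Nonempty V] {d : V → ℝ} (h : 0 ≤ ∑ v, d v) :
    ∃ v, 0 ≤ d v := by
  obtain ⟨v, _, hv⟩ := Finset.exists_le_of_sum_le (s := Finset.univ) (f := fun _ : V => (0 : ℝ))
    (g := d) Finset.univ_nonempty (by simpa using h)
  exact ⟨v, hv⟩

theorem neg_le_sub_single {d : V → ℝ} {b : ℝ} (hd : ∀ v, -b ≤ d v) {u : V} (hu : 0 ≤ d u) (v : V) :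
    -b ≤ (d - Pi.single u b : V → ℝ) v := by
  rcases eq_or_ne v u with rfl | hv
  · simp only [Pi.sub_apply, Pi.single_eq_same]
    linarith
  · simpa [hv] using hd v

theorem neg_le_add_single {d : V → ℝ} {b q : ℝ} (hq : 0 ≤ q) (hd : ∀ v, -b ≤ d v) (u v : V) :
    -b ≤ (d + Pi.single u q : V → ℝ) v :=
  (hd v).trans (le_add_single hq d u v)

/-- Simulation of a strategy for chips of weight `β` in the game with chips of weight `α`. The
vector `d` records by how much the opponent's real chips exceed the simulated ones, and `e` by how
much the strategy's simulated chips exceed the real ones. -/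
theorem RoundsInto.simulate_aux [Nonempty V] {α β : ℝ} (hα : 0 < α) (hβ : 0 < β)
    {U : (V → ℝ) → Prop} {C : ℝ}
    (hC : (2 * Fintype.card V + 1) * (α + β) + 2 * (2 * α + β) ≤ C) (N : ℕ) :
    ∀ (k l : ℕ) (y d e : V → ℝ), k + l ≤ N → RoundsInto β U k y → (∀ v, -β ≤ d v) →
      (∀ v, -α ≤ e v) → ∑ v, e v = -∑ v, d v → -β ≤ ∑ v, d v → ∑ v, d v ≤ α →
      α ≤ α * l + ∑ v, d v - β * k → α * l + ∑ v, d v - β * k ≤ 2 * α →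
      RoundsInto α (fun x => ∃ y, U y ∧ ∑ v, |x v - y v| ≤ C) l (y + d - e) := by
  have base (l : ℕ) (y d e : V → ℝ) (hy : U y) (hd : ∀ v, -β ≤ d v) (he : ∀ v, -α ≤ e v)
      (hs : ∑ v, e v = -∑ v, d v) (h1 : -β ≤ ∑ v, d v) (h2 : ∑ v, d v ≤ α)
      (h4 : α * l + ∑ v, d v ≤ 2 * α) :
      RoundsInto α (fun x => ∃ y, U y ∧ ∑ v, |x v - y v| ≤ C) l (y + d - e) := by
    -- The totals of d and e cancel, so their ℓ¹ norms add up to at most 2n(α + β); the leftover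
    -- rounds satisfy αl ≤ 2α + β and cost 2αl.
    refine .of_dist_le hα.le hy l (le_trans ?_ hC)
    have h5 : ∑ v, |(y + d - e) v - y v| ≤ ∑ v, (|d v| + |e v|) :=
      Finset.sum_le_sum fun v _ => by
        rw [show (y + d - e) v - y v = d v - e v by simp only [Pi.sub_apply, Pi.add_apply]; ring]
        exact abs_sub _ _
    rw [Finset.sum_add_distrib] at h5
    have h6 := sum_abs_le_of_neg_le hβ.le hd
    have h7 := sum_abs_le_of_neg_le hα.le he
    linarith
  induction N with
  | zero =>
    intro k l y d e hN hy hd he hs h1 h2 h3 h4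
    obtain ⟨rfl, rfl⟩ : k = 0 ∧ l = 0 := by omega
    exact base 0 y d e hy hd he hs h1 h2 (by simpa using h4)
  | succ N ih =>
    intro k l y d e hN hy hd he hs h1 h2 h3 h4
    rcases k with _ | k
    · exact base l y d e hy hd he hs h1 h2 (by simpa using h4)
    push_cast at h3 h4
    -- With a positive surplus, a simulated round uses up opponent weight; otherwise a real round is
    -- played. Each conserves αl + ∑ d - βk and lowers k + l by one.
    rcases lt_or_ge 0 (∑ v, d v) with hpos | hneg
    · obtain ⟨u, hu⟩ := exists_nonneg_of_sum_nonneg hpos.le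
      obtain ⟨v, hv⟩ := hy u
      have := ih k l _ (d - Pi.single u β) (e + Pi.single v β) (by omega) hv
        (neg_le_sub_single hd hu) (neg_le_add_single hβ.le he v)
        (by rw [sum_sub_single, sum_add_single]; linarith) (by rw [sum_sub_single]; linarith)
        (by rw [sum_sub_single]; linarith) (by rw [sum_sub_single]; linarith)
        (by rw [sum_sub_single]; linarith)
      convert this using 1
      abel
    · rcases l with _ | l
      · have : 0 ≤ β * k := by positivity
        push_cast at h3
        linarith
      intro u
      obtain ⟨v, hv⟩ := exists_nonneg_of_sum_nonneg (d := e) (by linarith)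
      push_cast at h3 h4
      have := ih (k + 1) l y (d + Pi.single u α) (e - Pi.single v α) (by omega) hy
        (neg_le_add_single hα.le hd u) (neg_le_sub_single he hv)
        (by rw [sum_sub_single, sum_add_single]; linarith) (by rw [sum_add_single]; linarith)
        (by rw [sum_add_single]; linarith) (by rw [sum_add_single]; push_cast; linarith)
        (by rw [sum_add_single]; push_cast; linarith)
      refine ⟨v, ?_⟩
      convert this using 1
      abel

theorem RoundsInto.simulate [Nonempty V] {α β : ℝ} (hα : 0 < α) (hβ : 0 < β)
    {U : (V → ℝ) → Prop} {k l : ℕ} {x : V → ℝ} (hx : RoundsInto β U k x)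
    (h1 : β * k + α ≤ α * l) (h2 : α * l ≤ β * k + 2 * α) :
    RoundsInto α (fun x => ∃ y, U y ∧ ∑ v, |x v - y v| ≤
      (2 * Fintype.card V + 1) * (α + β) + 2 * (2 * α + β)) l x := by
  have := RoundsInto.simulate_aux hα hβ le_rfl _ k l x 0 0 le_rfl hx (by simp [hβ.le])
    (by simp [hα.le]) (by simp) (by simp [hβ.le]) (by simp [hα.le]) (by simp; linarith)
    (by simp; linarith)
  simpa using this

/-- Compare x at j with y at j - δ. An entry off by at most δ loses nothing; any other loses at most
1 plus its error over n, hence at most twice its error over δ. -/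
theorem Overflowing.of_dist_le [Nonempty V] {x y : V → ℝ} (hy : Overflowing 0 y) {C : ℝ}
    (hC : ∑ v, |x v - y v| ≤ C) {δ : ℕ} (h0 : 0 < δ) (hδ : δ ≤ Fintype.card V) :
    Overflowing (δ + 2 * C / δ) x := by
  intro j
  have hn : (0 : ℝ) < Fintype.card V := by simp [Fintype.card_pos]
  have h0' : (0 : ℝ) < δ := by exact_mod_cast h0
  have hδ' : (δ : ℝ) ≤ Fintype.card V := by exact_mod_cast hδ
  have key (v : V) : (⌊(y v + ((j - δ : ℤ) : ℝ)) / (Fintype.card V : ℝ)⌋ : ℝ) ≤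
      ⌊(x v + j) / (Fintype.card V : ℝ)⌋ + 2 * |x v - y v| / δ := by
    have hxy := neg_abs_le (x v - y v)
    push_cast
    rcases le_or_gt |x v - y v| δ with h | h
    · have h1 : ⌊(y v + ((j : ℝ) - δ)) / (Fintype.card V : ℝ)⌋ ≤
          ⌊(x v + j) / (Fintype.card V : ℝ)⌋ :=
        Int.floor_le_floor (div_le_div_of_nonneg_right (by linarith) hn.le)
      have h2 : 0 ≤ 2 * |x v - y v| / δ := by positivity
      have h3 : (⌊(y v + ((j : ℝ) - δ)) / (Fintype.card V : ℝ)⌋ : ℝ) ≤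
          ⌊(x v + j) / (Fintype.card V : ℝ)⌋ := by exact_mod_cast h1
      linarith
    · have h1 := Int.floor_le ((y v + ((j : ℝ) - δ)) / (Fintype.card V : ℝ))
      have h2 := Int.lt_floor_add_one ((x v + j) / (Fintype.card V : ℝ))
      have h3 : (y v + ((j : ℝ) - δ)) / (Fintype.card V : ℝ) ≤
          (x v + j + |x v - y v|) / (Fintype.card V : ℝ) :=
        div_le_div_of_nonneg_right (by linarith) hn.le
      have h4 : |x v - y v| / (Fintype.card V : ℝ) ≤ |x v - y v| / δ :=
        div_le_div_of_nonneg_left (abs_nonneg _) h0' hδ'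
      have h5 : 1 ≤ |x v - y v| / δ := (one_le_div h0').2 h.le
      rw [add_div _ (|x v - y v|)] at h3
      rw [mul_div_assoc]
      linarith
  have h1 := hy (j - δ)
  have h2 := Finset.sum_le_sum fun v (_ : v ∈ Finset.univ) => key v
  rw [Finset.sum_add_distrib, ← Finset.sum_div, ← Finset.mul_sum] at h2
  have h3 : 2 * (∑ v, |x v - y v|) / δ ≤ 2 * C / δ := by gcongr
  push_cast at h1 h2 ⊢
  linarith

theorem Overflowing.add_single [Nonempty V] {m : ℝ} {x : V → ℝ} (hx : Overflowing m x) {M : ℕ}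
    (hM : m ≤ M) (u : V) : Overflowing 0 (x + Pi.single u (Fintype.card V * M : ℝ)) := by
  intro j
  have hn : (Fintype.card V : ℝ) ≠ 0 := by simp
  have h1 : (∑ v, ⌊((x + Pi.single u (Fintype.card V * M : ℝ) : V → ℝ) v + j) /
      (Fintype.card V : ℝ)⌋) = (∑ v, ⌊(x v + j) / (Fintype.card V : ℝ)⌋) + M := by
    have h1 : (M : ℤ) = ∑ v, (Pi.single u (M : ℤ) : V → ℤ) v := by simp
    conv_rhs => rw [h1]
    rw [← Finset.sum_add_distrib]
    refine Finset.sum_congr rfl fun v _ => ?_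
    rcases eq_or_ne v u with rfl | hv
    · simp only [Pi.add_apply, Pi.single_eq_same]
      rw [← Int.floor_add_intCast]
      congr 1
      push_cast
      field_simp
      ring
    · simp [hv]
  have := hx j
  rw [h1]
  push_cast at this ⊢
  linarith

/-- The second player always plays at w; the opponent's chips can only help. -/
theorem RoundsInto.of_add_single {q : ℝ} (hq : 0 ≤ q) (w : V) (k : ℕ) {x : V → ℝ}
    (hx : Overflowing 0 (x + Pi.single w (q * k))) : RoundsInto q (Overflowing 0) k x := by
  induction k generalizing x with
  | zero => simpa [RoundsInto] using hx
  | succ k ih =>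
    refine fun u => ⟨w, ih (hx.mono ?_)⟩
    calc x + Pi.single w (q * (k + 1 : ℕ)) = x + Pi.single w q + Pi.single w (q * k) := by
          rw [add_assoc, ← Pi.single_add]
          congr 2
          push_cast
          ring
      _ ≤ _ := add_le_add_left (add_le_add_left (le_add_single hq x u) _) _

end Simulation

/-! ### Bounds and comparison for the game length -/

section PlacementNumber

/-- The least number of placements of chips of weight `q` within which Min can force an overflowing
assignment on `V`, when Max begins. -/
noncomputable def placementNumber (V : Type*) [Fintype V] [DecidableEq V] (q : ℝ) : ℕ :=
  sInf {k | ForcedWithin q k .maxPlayer (0 : V → ℝ)}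

variable {V : Type*} [Fintype V] [DecidableEq V] [Nonempty V]

theorem topplingNumber_top_eq [DecidableRel (⊤ : SimpleGraph V).Adj] :
    topplingNumber (⊤ : SimpleGraph V) = placementNumber V 1 := by
  have hcard : 1 ≤ Fintype.card V := Fintype.card_pos
  have hdeg (v : V) : (⊤ : SimpleGraph V).degree v = Fintype.card V - 1 := by
    convert SimpleGraph.complete_graph_degree v
  unfold topplingNumber gameLength placementNumber
  congr 1
  ext k
  have := minForcesWithin_iff (V := V) (φ := fun c v => (c v : ℝ))
    (fires := OrdinaryFires (⊤ : SimpleGraph V)) zero_le_one ?_ ?_ ?_ k .maxPlayer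
    (c := fun _ => 0) (fun v => by simp)
  · refine this.trans (iff_of_eq (congrArg _ ?_))
    ext v
    simp
  · rintro c c' ⟨u, hu, h⟩
    rw [hdeg] at hu
    refine ⟨u, ?_, ?_⟩
    · rw [← Nat.cast_one, ← Nat.cast_sub hcard]
      exact_mod_cast hu
    · ext v
      have hv := h v
      rcases eq_or_ne v u with rfl | hne
      · rw [if_pos rfl, hdeg] at hv
        rw [hv, Nat.cast_sub hu, Nat.cast_sub hcard]
        simp
        ring
      · rw [if_neg hne, if_pos (by simpa using hne.symm)] at hv
        simp [hv, hne]
  · intro c u hu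
    refine ⟨_, u, ?_, fun v => rfl⟩
    rw [hdeg]
    rw [← Nat.cast_one, ← Nat.cast_sub hcard] at hu
    exact_mod_cast hu
  · intro c v
    ext u
    rcases eq_or_ne u v with rfl | hne
    · simp [addChip]
    · simp [addChip, hne]

theorem fractionalTopplingNumber_top_eq [DecidableRel (⊤ : SimpleGraph V).Adj] {p : ℝ}
    (hp : 0 < p) :
    fractionalTopplingNumber (⊤ : SimpleGraph V) p = placementNumber V (1 / p) := by
  have hcard : 1 ≤ Fintype.card V := Fintype.card_pos
  have hdeg (v : V) : ((⊤ : SimpleGraph V).degree v : ℝ) = Fintype.card V - 1 := by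
    rw [← Nat.cast_one, ← Nat.cast_sub hcard]
    congr 1
    convert SimpleGraph.complete_graph_degree v
  unfold fractionalTopplingNumber gameLength placementNumber
  congr 1
  ext k
  have := minForcesWithin_iff (V := V) (φ := fun c v => c v / p)
    (fires := FractionalFires (⊤ : SimpleGraph V) p) (one_div_pos.2 hp).le ?_ ?_ ?_ k .maxPlayer
    (c := fun _ => 0) (fun v => by simp)
  · refine this.trans (iff_of_eq (congrArg _ ?_))
    ext v
    simp
  · rintro c c' ⟨u, hu, h⟩
    rw [hdeg] at hu
    refine ⟨u, by rwa [le_div_iff₀' hp], ?_⟩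
    ext v
    have hv := h v
    rcases eq_or_ne v u with rfl | hne
    · rw [if_pos rfl, hdeg] at hv
      simp only [hv, Pi.sub_apply, Pi.add_apply, Pi.one_apply, Pi.single_eq_same]
      field_simp
      ring
    · rw [if_neg hne, if_pos (by simpa using hne.symm)] at hv
      simp only [hv, Pi.sub_apply, Pi.add_apply, Pi.one_apply, Pi.single_eq_of_ne hne]
      field_simp
      ring
  · intro c u hu
    refine ⟨_, u, ?_, fun v => rfl⟩
    rwa [hdeg, ← le_div_iff₀' hp]
  · intro c v
    ext u
    rcases eq_or_ne u v with rfl | hne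
    · simp [addChip, add_div]
    · simp [addChip, hne]

theorem forcedWithin_two_mul {q : ℝ} (hq : 0 ≤ q) {k : ℕ}
    (hk : (Fintype.card V : ℝ) * Fintype.card V ≤ q * k) :
    ForcedWithin q (2 * k) .maxPlayer (0 : V → ℝ) := by
  have hn : (0 : ℝ) < Fintype.card V := by simp [Fintype.card_pos]
  -- The empty assignment has deficit at most n, so weight n² on one vertex suffices.
  have h0 : Overflowing (Fintype.card V) (0 : V → ℝ) := by
    intro j
    have := (Int.lt_floor_add_one ((0 + j : ℝ) / Fintype.card V)).le
    rw [div_le_iff₀ hn] at this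
    simp only [Pi.zero_apply, Finset.sum_const, Finset.card_univ, nsmul_eq_mul]
    push_cast
    linarith
  rw [forcedWithin_iff_roundsInto]
  refine .of_add_single hq (Classical.arbitrary V) k
    ((h0.add_single le_rfl (Classical.arbitrary V)).mono ?_)
  exact add_le_add_right (Pi.single_mono _ hk) _

/-- The infimum is attained, not the default value of an empty set. -/
theorem forcedWithin_placementNumber {q : ℝ} (hq : 0 < q) :
    ForcedWithin q (placementNumber V q) .maxPlayer (0 : V → ℝ) := by
  refine Nat.sInf_mem (s := {k | ForcedWithin q k .maxPlayer (0 : V → ℝ)})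
    ⟨2 * ⌈(Fintype.card V : ℝ) * Fintype.card V / q⌉₊, forcedWithin_two_mul hq.le ?_⟩
  rw [← div_le_iff₀' hq]
  exact Nat.le_ceil _

theorem mul_ceil_div_le {q a : ℝ} (hq : 0 < q) (ha : 0 ≤ a) : q * (⌈a / q⌉₊ : ℝ) ≤ a + q := by
  have := (Nat.ceil_lt_add_one (div_nonneg ha hq.le)).le
  calc q * (⌈a / q⌉₊ : ℝ) ≤ q * (a / q + 1) := by gcongr
    _ = a + q := by field_simp

theorem mul_placementNumber_le {q : ℝ} (hq : 0 < q) :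
    q * placementNumber V q ≤ 2 * ((Fintype.card V : ℝ) ^ 2 + q) := by
  have h1 : placementNumber V q ≤ 2 * ⌈(Fintype.card V : ℝ) * Fintype.card V / q⌉₊ :=
    Nat.sInf_le (forcedWithin_two_mul hq.le (by rw [← div_le_iff₀' hq]; exact Nat.le_ceil _))
  have h2 : (placementNumber V q : ℝ) ≤ 2 * ⌈(Fintype.card V : ℝ) * Fintype.card V / q⌉₊ := by
    exact_mod_cast h1
  have h3 := mul_ceil_div_le hq (by positivity : 0 ≤ (Fintype.card V : ℝ) * Fintype.card V)
  nlinarith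

theorem ForcedWithin.exists_sum_eq {q : ℝ} (hq : 0 ≤ q) {k : ℕ} {P : ToppPlayer} {x : V → ℝ}
    (h : ForcedWithin q k P x) (hx : 0 ≤ x) :
    ∃ y : V → ℝ, 0 ≤ y ∧ Overflowing 0 y ∧ ∑ v, y v = ∑ v, x v + q * k := by
  induction k generalizing P x with
  | zero => exact ⟨x, hx, h, by simp⟩
  | succ k ih =>
    obtain ⟨v, P', hv⟩ : ∃ v P', ForcedWithin q k P' (x + Pi.single v q) := by
      cases P with
      | maxPlayer => exact ⟨Classical.arbitrary V, _, h _⟩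
      | minPlayer =>
        obtain ⟨v, hv⟩ := h
        exact ⟨v, _, hv⟩
    obtain ⟨y, h0, h1, h2⟩ := ih hv (hx.trans (le_add_single hq x v))
    refine ⟨y, h0, h1, ?_⟩
    rw [h2, sum_add_single]
    push_cast
    ring

/-- Take j = ⌊n/2⌋: an entry y has a positive floor only if y ≥ n - j ≥ j, and then (y + j)/n ≤
2y/n. Summing, jn ≤ 2∑ y. -/
theorem Overflowing.le_sum {y : V → ℝ} (hy : Overflowing 0 y) (h0 : 0 ≤ y)
    (hV : 2 ≤ Fintype.card V) : (Fintype.card V : ℝ) ^ 2 / 8 ≤ ∑ v, y v := by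
  have hn : (2 : ℝ) ≤ Fintype.card V := by exact_mod_cast hV
  have hn0 : (0 : ℝ) < Fintype.card V := by linarith
  set j : ℕ := Fintype.card V / 2 with hj
  have hj1 : 2 * (j : ℝ) ≤ Fintype.card V := by
    have : 2 * j ≤ Fintype.card V := by omega
    exact_mod_cast this
  have hj2 : (Fintype.card V : ℝ) ≤ 2 * j + 1 := by
    have : Fintype.card V ≤ 2 * j + 1 := by omega
    exact_mod_cast this
  have key (v : V) : (⌊(y v + (j : ℤ)) / (Fintype.card V : ℝ)⌋ : ℝ) ≤
      2 / Fintype.card V * y v := by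
    have hv : 0 ≤ y v := h0 v
    rcases lt_or_ge (y v + j) (Fintype.card V) with h | h
    · have h1 : ⌊(y v + (j : ℤ)) / (Fintype.card V : ℝ)⌋ ≤ 0 := by
        rw [← Int.lt_add_one_iff, Int.floor_lt, div_lt_iff₀ hn0]
        push_cast
        linarith
      have h2 : (⌊(y v + (j : ℤ)) / (Fintype.card V : ℝ)⌋ : ℝ) ≤ 0 := by exact_mod_cast h1
      exact h2.trans (by positivity)
    · refine (Int.floor_le _).trans ?_
      rw [div_mul_eq_mul_div]
      refine div_le_div_of_nonneg_right ?_ hn0.le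
      push_cast
      linarith
  have h1 := hy j
  have h2 := Finset.sum_le_sum fun v (_ : v ∈ Finset.univ) => key v
  rw [← Finset.mul_sum, div_mul_eq_mul_div, le_div_iff₀ hn0] at h2
  push_cast at h1 h2
  nlinarith

theorem le_mul_placementNumber {q : ℝ} (hq : 0 < q) (hV : 2 ≤ Fintype.card V) :
    (Fintype.card V : ℝ) ^ 2 / 8 ≤ q * placementNumber V q := by
  obtain ⟨y, h0, h1, h2⟩ := (forcedWithin_placementNumber (V := V) hq).exists_sum_eq hq.le le_rfl
  have := h1.le_sum h0 hV
  simpa [h2] using this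

theorem mul_placementNumber_le_add {α β Q ε : ℝ} (hα : 0 < α) (hβ : 0 < β) (hαQ : α ≤ Q)
    (hβQ : β ≤ Q) (hε : 0 < ε) (hε1 : ε ≤ 1) :
    α * placementNumber V α ≤ β * placementNumber V β +
      (7 * Q + 2 * (Fintype.card V * (ε * Fintype.card V + 2 + 24 * Q / ε))) := by
  have hn : (1 : ℝ) ≤ Fintype.card V := by exact_mod_cast Fintype.card_pos (α := V)
  set n := (Fintype.card V : ℝ)
  have hQ : 0 < Q := hα.trans_le hαQ
  -- Rounding up to whole rounds costs at most one chip of weight β.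
  set k := (placementNumber V β + 1) / 2
  have hk1 : placementNumber V β ≤ 2 * k := by omega
  have hk2 : (2 * k : ℝ) ≤ placementNumber V β + 1 := by
    have : 2 * k ≤ placementNumber V β + 1 := by omega
    exact_mod_cast this
  have hβk : RoundsInto β (Overflowing 0) k (0 : V → ℝ) :=
    (forcedWithin_iff_roundsInto _ _ _).1 ((forcedWithin_placementNumber hβ).mono hβ.le hk1)
  set l := ⌈(β * k + α) / α⌉₊
  have hl1 : β * k + α ≤ α * l := by
    rw [← div_le_iff₀' hα]
    exact Nat.le_ceil _
  have hl2 : α * l ≤ β * k + α + α := mul_ceil_div_le hα (by positivity)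
  set δ := ⌈ε * n⌉₊
  have hδ0 : 0 < δ := Nat.ceil_pos.2 (by positivity)
  have hδ1 : δ ≤ Fintype.card V := Nat.ceil_le.2 (by nlinarith)
  have hδ2 : ε * n ≤ δ := Nat.le_ceil _
  have hδ3 : (δ : ℝ) ≤ ε * n + 1 := (Nat.ceil_lt_add_one (by positivity)).le
  -- The simulation error is at most (2n + 1)·2Q + 6Q ≤ 12nQ.
  set m : ℝ := δ + 2 * (12 * n * Q) / δ with hm
  have hm0 : 0 ≤ m := by positivity
  have hm1 : m ≤ ε * n + 1 + 24 * Q / ε := by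
    have : 2 * (12 * n * Q) / δ ≤ 2 * (12 * n * Q) / (ε * n) := by gcongr
    have h2 : 2 * (12 * n * Q) / (ε * n) = 24 * Q / ε := by
      field_simp
      ring
    linarith
  set M := ⌈m⌉₊
  have hM : (M : ℝ) ≤ m + 1 := (Nat.ceil_lt_add_one hm0).le
  set k' := ⌈n * M / α⌉₊
  have hk'1 : n * M ≤ α * k' := by
    rw [← div_le_iff₀' hα]
    exact Nat.le_ceil _
  have hk'2 : α * k' ≤ n * M + α := mul_ceil_div_le hα (by positivity)
  have hαl : RoundsInto α (RoundsInto α (Overflowing 0) k') l (0 : V → ℝ) := by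
    refine (hβk.simulate hα hβ hl1 (by linarith)).imp ?_
    rintro x ⟨y, hy, hxy⟩
    have hx : Overflowing m x := by
      refine hy.of_dist_le (hxy.trans ?_) hδ0 hδ1
      nlinarith
    refine .of_add_single hα.le (Classical.arbitrary V) _
      ((hx.add_single (Nat.le_ceil m) (Classical.arbitrary V)).mono ?_)
    exact add_le_add_right (Pi.single_mono _ hk'1) _
  have hle : placementNumber V α ≤ 2 * (k' + l) :=
    Nat.sInf_le ((forcedWithin_iff_roundsInto _ _ _).2 hαl.add)
  have hle' : (placementNumber V α : ℝ) ≤ 2 * (k' + l) := by exact_mod_cast hle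
  have h1 : α * placementNumber V α ≤ α * (2 * (k' + l)) := by gcongr
  have h2 : β * (2 * k) ≤ β * (placementNumber V β + 1) := by gcongr
  have h3 : n * M ≤ n * (ε * n + 2 + 24 * Q / ε) := by gcongr; linarith
  linarith

end PlacementNumber

/-! ### Asymptotics -/

theorem corollary10 (p : ℕ → ℝ) (hp : ∀ᶠ n in atTop, 0 < p n ∧ p n < 1)
    (hpn : (fun n : ℕ => 1 / (n : ℝ)) =o[atTop] p) :
    ((fun n : ℕ => (fractionalTopplingNumber (⊤ : SimpleGraph (Fin n)) (p n) : ℝ)) ~[atTop]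
        fun n : ℕ => p n * (topplingNumber (⊤ : SimpleGraph (Fin n)) : ℝ)) ∧
      ((fun n : ℕ => (fractionalTopplingNumber (⊤ : SimpleGraph (Fin n)) (p n) : ℝ)) =Θ[atTop]
        fun n : ℕ => p n * (n : ℝ) ^ 2) ∧
      ((fun n : ℕ => p n * (topplingNumber (⊤ : SimpleGraph (Fin n)) : ℝ)) =Θ[atTop]
        fun n : ℕ => p n * (n : ℝ) ^ 2) := by
  have hbounds : ∀ᶠ n : ℕ in atTop,
      (n : ℝ) ^ 2 / 8 ≤ topplingNumber (⊤ : SimpleGraph (Fin n)) ∧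
        (topplingNumber (⊤ : SimpleGraph (Fin n)) : ℝ) ≤ 4 * (n : ℝ) ^ 2 := by
    filter_upwards [eventually_ge_atTop 2] with n hn
    have : Nonempty (Fin n) := ⟨⟨0, by omega⟩⟩
    have h1 := le_mul_placementNumber (V := Fin n) one_pos (by simpa using hn)
    have h2 := mul_placementNumber_le (V := Fin n) one_pos
    rw [← topplingNumber_top_eq, Fintype.card_fin, one_mul] at h1 h2
    have hn' : (2 : ℝ) ≤ n := by exact_mod_cast hn
    exact ⟨h1, by nlinarith⟩
  have htheta : (fun n : ℕ => (topplingNumber (⊤ : SimpleGraph (Fin n)) : ℝ)) =Θ[atTop]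
      fun n : ℕ => (n : ℝ) ^ 2 := by
    constructor
    · refine .of_bound 4 (hbounds.mono fun n h => ?_)
      rw [Real.norm_of_nonneg (by positivity), Real.norm_of_nonneg (by positivity)]
      exact h.2
    · refine .of_bound 8 (hbounds.mono fun n h => ?_)
      rw [Real.norm_of_nonneg (by positivity), Real.norm_of_nonneg (by positivity)]
      linarith [h.1]
  have hptheta : (fun n : ℕ => p n * (topplingNumber (⊤ : SimpleGraph (Fin n)) : ℝ)) =Θ[atTop]
      fun n : ℕ => p n * (n : ℝ) ^ 2 := (isTheta_refl p atTop).mul htheta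
  have hequiv : (fun n : ℕ => (fractionalTopplingNumber (⊤ : SimpleGraph (Fin n)) (p n) : ℝ))
      ~[atTop] fun n : ℕ => p n * (topplingNumber (⊤ : SimpleGraph (Fin n)) : ℝ) := by
    refine isLittleO_iff.2 fun c hc => ?_
    -- The error will be at most 4εn², and t ≥ n²/8, whence 32.
    obtain ⟨ε, hε, hε1, hεc⟩ : ∃ ε : ℝ, 0 < ε ∧ ε ≤ 1 ∧ 32 * ε ≤ c :=
      ⟨min 1 (c / 32), by positivity, min_le_left _ _, by linarith [min_le_right 1 (c / 32)]⟩
    -- The error contains Q/ε with coefficients 7 and 2·24, in total 55.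
    have hη : 0 < ε ^ 2 / 55 := by positivity
    filter_upwards [hp, hpn.def hη, hbounds, eventually_ge_atTop 2,
      eventually_ge_atTop ⌈4 / ε⌉₊] with n hpn1 hsmall hb hn hnε
    obtain ⟨hp0, hp1⟩ := hpn1
    have : Nonempty (Fin n) := ⟨⟨0, by omega⟩⟩
    have hn' : (2 : ℝ) ≤ n := by exact_mod_cast hn
    have hnε' : 4 ≤ ε * n := by
      rw [← div_le_iff₀' hε]
      exact (Nat.le_ceil _).trans (by exact_mod_cast hnε)
    rw [Real.norm_of_nonneg (by positivity), Real.norm_of_nonneg hp0.le] at hsmall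
    set Q := 1 / p n with hQ
    have hQ1 : 1 ≤ Q := (one_le_div hp0).2 hp1.le
    have hQp : p n * Q = 1 := by rw [hQ]; field_simp
    have hQn : 55 * (Q / ε) ≤ ε * n := by
      rw [div_le_iff₀ (by linarith)] at hsmall
      have h1 : Q ≤ ε ^ 2 / 55 * n := by
        rw [hQ, div_le_iff₀ hp0]
        linarith
      have h2 : Q / ε ≤ (ε ^ 2 / 55 * n) / ε := by gcongr
      have h3 : (ε ^ 2 / 55 * n) / ε = ε * n / 55 := by field_simp
      linarith
    have hQε : Q ≤ Q / ε := le_div_self (by linarith) hε hε1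
    have e1 := mul_placementNumber_le_add (V := Fin n) (ε := ε) one_pos (by linarith) hQ1 le_rfl
      hε hε1
    have e2 := mul_placementNumber_le_add (V := Fin n) (ε := ε) (by linarith) one_pos le_rfl hQ1
      hε hε1
    rw [hQ, ← fractionalTopplingNumber_top_eq hp0, ← topplingNumber_top_eq, ← hQ,
      Fintype.card_fin] at e1 e2
    set t : ℝ := (topplingNumber (⊤ : SimpleGraph (Fin n)) : ℝ)
    set tp : ℝ := (fractionalTopplingNumber (⊤ : SimpleGraph (Fin n)) (p n) : ℝ)
    have herr : 7 * Q + 2 * (n * (ε * n + 2 + 24 * Q / ε)) ≤ c * t := by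
      have h1 : c * ((n : ℝ) ^ 2 / 8) ≤ c * t := by
        have := hb.1
        gcongr
      have h2 : 32 * ε * ((n : ℝ) ^ 2 / 8) ≤ c * ((n : ℝ) ^ 2 / 8) := by gcongr
      have h3 : 7 * Q ≤ n * (7 * (Q / ε)) := by nlinarith
      have h4 : n * (7 * (Q / ε) + 2 * (ε * n + 2 + 24 * (Q / ε))) ≤ n * (4 * (ε * n)) := by
        gcongr
        linarith
      rw [mul_div_assoc]
      nlinarith
    have habs : |Q * tp - t| ≤ c * t := abs_le.2 ⟨by linarith, by linarith⟩
    have hfac : tp - p n * t = p n * (Q * tp - t) := by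
      linear_combination (-tp) * hQp
    rw [Pi.sub_apply, Real.norm_eq_abs, Real.norm_of_nonneg (by positivity)]
    change |tp - p n * t| ≤ c * (p n * t)
    rw [hfac, abs_mul, abs_of_pos hp0]
    calc p n * |Q * tp - t| ≤ p n * (c * t) := by gcongr
      _ = _ := by ring
  exact ⟨hequiv, hequiv.isTheta.trans hptheta, hptheta⟩
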